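/- Let $q:\mathbb R\to\mathbb R$ be locally integrable and even ($q(-x)=q(x)$ for all $x$), and suppose that $\tau_q(y)=-y''-qy$ is in the limit circle case at $+\infty$ and at $-\infty$, i.e. for every $\lambda\in\mathbb C$ every solution of $\tau_q(y)=\lambda y$ lies in $L^2((a,\infty))$ and in $L^2((-\infty,a))$ for some $a\in\mathbb R$. Let $$\mathcal D_{\max}=\{y\in L^2(\mathbb R): y,y'\in AC_{loc}(\mathbb R),\ \tau_q(y)\in L^2(\mathbb R)\}$$ and let $A_{\max}y=\tau_q(y)$ for $y\in\mathcal D_{\max}$. Put $[f,g]_x=\overline{f(x)}g'(x)-\overline{f'(x)}g(x)$ and $[f,g]_{\pm\infty}=\lim_{x\to\pm\infty}[f,g]_x$. Let $w_1,w_2$ be real-valued solutions of $\tau_q(y)=0$ with $w_1$ odd, $w_2$ even and $[w_1,w_2]_{-\infty}=[w_1,w_2]_{\infty}=1$, and for $f\in\mathcal D_{\max}$ and $j=1,2$ set $\alpha_j(f)=[w_j,f]_{-\infty}$ and $\beta_j(f)=[w_j,f]_{\infty}$. Let $(\mathcal Pf)(x)=f(-x)$ on $L^2(\mathbb R)$.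 A closed densely defined operator $H$ in $L^2(\mathbb R)$ is called $\mathcal P$-self-adjoint if $\operatorname{dom}H=\{f:\mathcal Pf\in\operatorname{dom}H^*\}$ and $Hf=\mathcal PH^*\mathcal Pf$ for all $f\in\operatorname{dom}H$. Below, $\widetilde A$ is the restriction of $A_{\max}$ to the indicated domain. 1. (Separated conditions.) Let $\xi,\eta\in\mathbb C$ with $|\xi|=|\eta|=1$, let $\alpha,\beta\in[0,2\pi)$, and let $\operatorname{dom}\widetilde A$ be the set of all $f\in\mathcal D_{\max}$ with $$\alpha_1(f)\,\xi\cos\alpha-\alpha_2(f)\sin\alpha=0,\qquad \beta_1(f)\,\eta\cos\beta-\beta_2(f)\sin\beta=0.$$ (i) If $\alpha\in\{0,\pi/2,\pi,3\pi/2\}$ or $\beta\in\{0,\pi/2,\pi,3\pi/2\}$, then $\widetilde A$ is $\mathcal P$-self-adjoint if and only if $\alpha+\beta\equiv0\pmod\pi$. (ii) If $\alpha,\beta\notin\{0,\pi/2,\pi,3\pi/2\}$, then $\widetilde A$ is $\mathcal P$-self-adjoint if and only if either $\alpha+\beta\equiv0\pmod\pi$ and $\xi\eta=1$, or $|\alpha-\beta|\equiv0\pmod\pi$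 and $\xi\eta=-1$. 2. (Mixed conditions.) Let $a,b,c,d\in\mathbb C$ and let $\operatorname{dom}\widetilde A$ be either the set of all $f\in\mathcal D_{\max}$ with $$\begin{pmatrix}\alpha_1(f)\\ \alpha_2(f)\end{pmatrix}=\begin{pmatrix}a&b\\c&d\end{pmatrix}\begin{pmatrix}\beta_1(f)\\ \beta_2(f)\end{pmatrix},$$ or the set of all $f\in\mathcal D_{\max}$ with $$\begin{pmatrix}\beta_1(f)\\ \beta_2(f)\end{pmatrix}=\begin{pmatrix}a&b\\c&d\end{pmatrix}\begin{pmatrix}\alpha_1(f)\\ \alpha_2(f)\end{pmatrix}.$$ In both cases $\widetilde A$ is $\mathcal P$-self-adjoint if and only if $d=\overline a$ and $b,c\in\mathbb R$. -/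

import Mathlib

open MeasureTheory Filter Topology

noncomputable section

namespace PTSL

/-! ### The differential expression and its solutions -/

/-- Local absolute continuity: absolute continuity on every compact interval. -/
def ACLoc (f : ℝ → ℂ) : Prop :=
  ∀ a b : ℝ, AbsolutelyContinuousOnInterval f a b

/-- The differential expression `τ_q y = - y'' - q y`. -/
def tau (q : ℝ → ℝ) (y : ℝ → ℂ) (x : ℝ) : ℂ :=
  -deriv (deriv y) x - (q x : ℂ) * y x

/-- `y` and `y'` are locally absolutely continuous (so that `y` is continuously differentiable
and `y''` exists almost everywhere). -/
structure IsRegular (y : ℝ → ℂ) : Prop where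
  differentiable : Differentiable ℝ y
  acLoc : ACLoc y
  acLoc_deriv : ACLoc (deriv y)

/-- `y` solves `τ_q y = z y` (almost everywhere, in the Carathéodory sense). -/
def IsSolution (q : ℝ → ℝ) (z : ℂ) (y : ℝ → ℂ) : Prop :=
  IsRegular y ∧ ∀ᵐ x : ℝ, tau q y x = z * y x

/-- `τ_q` is in the limit circle case at `+∞`. -/
def LimitCircleAtTop (q : ℝ → ℝ) : Prop :=
  ∀ (z : ℂ) (y : ℝ → ℂ), IsSolution q z y →
    ∃ a : ℝ, MemLp y 2 (volume.restrict (Set.Ioi a))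

/-- `τ_q` is in the limit circle case at `-∞`. -/
def LimitCircleAtBot (q : ℝ → ℝ) : Prop :=
  ∀ (z : ℂ) (y : ℝ → ℂ), IsSolution q z y →
    ∃ a : ℝ, MemLp y 2 (volume.restrict (Set.Iio a))

/-- The bracket `[f, g]_x = conj (f x) * g' x - conj (f' x) * g x`. -/
def bracket (f g : ℝ → ℂ) (x : ℝ) : ℂ :=
  (starRingEnd ℂ) (f x) * deriv g x - (starRingEnd ℂ) (deriv f x) * g x

/-- `w₁`, `w₂` are real-valued solutions of `τ_q y = 0`, `w₁` odd and `w₂` even, normalized by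
`[w₁, w₂]_{-∞} = [w₁, w₂]_{∞} = 1`. -/
structure IsNormalizedPair (q : ℝ → ℝ) (w₁ w₂ : ℝ → ℂ) : Prop where
  solution_fst : IsSolution q 0 w₁
  solution_snd : IsSolution q 0 w₂
  real_fst : ∀ x, (w₁ x).im = 0
  real_snd : ∀ x, (w₂ x).im = 0
  odd_fst : ∀ x, w₁ (-x) = -w₁ x
  even_snd : ∀ x, w₂ (-x) = w₂ x
  bracket_atTop : Tendsto (bracket w₁ w₂) atTop (𝓝 1)
  bracket_atBot : Tendsto (bracket w₁ w₂) atBot (𝓝 1)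

/-! ### The maximal domain -/

/-- The complex Hilbert space `L²(ℝ)`. -/
abbrev L2 : Type := Lp ℂ 2 (volume : Measure ℝ)

theorem ACLoc.continuous {f : ℝ → ℂ} (hf : ACLoc f) : Continuous f := by
  rw [continuous_iff_continuousAt]
  intro x
  refine (hf (x - 1) (x + 1)).continuousOn.continuousAt ?_
  rw [Set.uIcc_of_le (by linarith)]
  exact Icc_mem_nhds (by linarith) (by linarith)

theorem ACLoc.ae_differentiableAt {f : ℝ → ℂ} (hf : ACLoc f) :
    ∀ᵐ x : ℝ, DifferentiableAt ℝ f x := by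
  have h : ∀ n : ℕ, ∀ᵐ x : ℝ, x ∈ Set.uIcc (-(n : ℝ)) n → DifferentiableAt ℝ f x := fun n =>
    (hf (-(n : ℝ)) n).boundedVariationOn.ae_differentiableAt_of_mem_uIcc
  filter_upwards [ae_all_iff.2 h] with x hx
  obtain ⟨n, hn⟩ := exists_nat_ge |x|
  refine hx n ?_
  rw [Set.uIcc_of_le (by linarith [abs_nonneg x])]
  exact abs_le.1 hn

theorem IsRegular.add {y z : ℝ → ℂ} (hy : IsRegular y) (hz : IsRegular z) :
    IsRegular (y + z) where
  differentiable := hy.differentiable.add hz.differentiable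
  acLoc a b := (hy.acLoc a b).add (hz.acLoc a b)
  acLoc_deriv a b := by
    have h : deriv (y + z) = deriv y + deriv z := by
      ext x
      exact deriv_add (hy.differentiable x) (hz.differentiable x)
    rw [h]
    exact (hy.acLoc_deriv a b).add (hz.acLoc_deriv a b)

theorem IsRegular.smul {y : ℝ → ℂ} (c : ℂ) (hy : IsRegular y) : IsRegular (c • y) where
  differentiable := hy.differentiable.const_smul c
  acLoc a b := (hy.acLoc a b).const_smul c
  acLoc_deriv a b := by
    have h : deriv (c • y) = c • deriv y := by
      ext x
      exact deriv_const_smul c (hy.differentiable x)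
    rw [h]
    exact (hy.acLoc_deriv a b).const_smul c

theorem IsRegular.zero : IsRegular (0 : ℝ → ℂ) := by
  have h0 : ACLoc (0 : ℝ → ℂ) := fun a b => by
    simpa [AbsolutelyContinuousOnInterval] using tendsto_const_nhds
  refine ⟨differentiable_const (0 : ℂ), h0, ?_⟩
  have h : deriv (0 : ℝ → ℂ) = 0 := by
    ext x
    exact deriv_const x (0 : ℂ)
  rw [h]
  exact h0

theorem tau_zero (q : ℝ → ℝ) : tau q 0 = 0 := by
  have h : deriv (0 : ℝ → ℂ) = 0 := by
    ext x
    exact deriv_const x (0 : ℂ)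
  ext x
  simp [tau, h]

theorem tau_add (q : ℝ → ℝ) {y z : ℝ → ℂ} (hy : IsRegular y) (hz : IsRegular z) :
    tau q (y + z) =ᵐ[volume] tau q y + tau q z := by
  have h : deriv (y + z) = deriv y + deriv z := by
    ext x
    exact deriv_add (hy.differentiable x) (hz.differentiable x)
  filter_upwards [hy.acLoc_deriv.ae_differentiableAt, hz.acLoc_deriv.ae_differentiableAt]
    with x h1 h2
  have h3 : deriv (deriv y + deriv z) x = deriv (deriv y) x + deriv (deriv z) x :=
    deriv_add h1 h2
  simp only [tau, h, h3, Pi.add_apply]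
  ring

theorem tau_smul (q : ℝ → ℝ) (c : ℂ) {y : ℝ → ℂ} (hy : IsRegular y) :
    tau q (c • y) =ᵐ[volume] c • tau q y := by
  have h : deriv (c • y) = c • deriv y := by
    ext x
    exact deriv_const_smul c (hy.differentiable x)
  filter_upwards [hy.acLoc_deriv.ae_differentiableAt] with x h1
  have h3 : deriv (c • deriv y) x = c • deriv (deriv y) x := deriv_const_smul c h1
  simp only [tau, h, h3, Pi.smul_apply, smul_eq_mul]
  ring

/-- The maximal domain: all `y ∈ L²(ℝ)` with `y`, `y'` locally absolutely continuous and
`τ_q y ∈ L²(ℝ)`. Its elements are functions; each is the unique continuous representative of its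
class in `L²(ℝ)`. -/
def maxDomain (q : ℝ → ℝ) : Submodule ℂ (ℝ → ℂ) where
  carrier := {y | IsRegular y ∧ MemLp y 2 volume ∧ MemLp (tau q y) 2 volume}
  zero_mem' := ⟨IsRegular.zero, MemLp.zero, by rw [tau_zero]; exact MemLp.zero⟩
  add_mem' := fun hy hz => ⟨hy.1.add hz.1, hy.2.1.add hz.2.1,
    (memLp_congr_ae (tau_add q hy.1 hz.1)).2 (hy.2.2.add hz.2.2)⟩
  smul_mem' := fun c _ hy => ⟨hy.1.smul c, hy.2.1.const_smul c,
    (memLp_congr_ae (tau_smul q c hy.1)).2 (hy.2.2.const_smul c)⟩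

/-- The class in `L²(ℝ)` of an element of the maximal domain. -/
def toL2 (q : ℝ → ℝ) : maxDomain q →ₗ[ℂ] L2 where
  toFun y := MemLp.toLp (y : ℝ → ℂ) y.2.2.1
  map_add' _ _ := rfl
  map_smul' _ _ := rfl

/-- The class of `τ_q y` in `L²(ℝ)`, for `y` in the maximal domain. -/
def tauL2 (q : ℝ → ℝ) : maxDomain q →ₗ[ℂ] L2 where
  toFun y := MemLp.toLp (tau q (y : ℝ → ℂ)) y.2.2.2
  map_add' y z := by
    rw [← MemLp.toLp_add y.2.2.2 z.2.2.2, MemLp.toLp_eq_toLp_iff]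
    exact tau_add q y.2.1 z.2.1
  map_smul' c y := by
    rw [RingHom.id_apply, ← MemLp.toLp_const_smul c y.2.2.2, MemLp.toLp_eq_toLp_iff]
    exact tau_smul q c y.2.1

theorem toL2_injective (q : ℝ → ℝ) : Function.Injective (toL2 q) := by
  intro y z h
  have h1 : (y : ℝ → ℂ) =ᵐ[volume] (z : ℝ → ℂ) := (MemLp.toLp_eq_toLp_iff y.2.2.1 z.2.2.1).1 h
  exact Subtype.ext
    ((Continuous.ae_eq_iff_eq volume y.2.1.acLoc.continuous z.2.1.acLoc.continuous).1 h1)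

/-- The restriction of the maximal operator `y ↦ τ_q y` in `L²(ℝ)` to the linear subspace `D` of
the maximal domain. For `D = ⊤` it is the maximal operator itself. -/
def restrictedOperator (q : ℝ → ℝ) (D : Submodule ℂ (maxDomain q)) : L2 →ₗ.[ℂ] L2 where
  domain := D.map (toL2 q)
  toFun := (tauL2 q).comp (D.subtype.comp
    (Submodule.equivMapOfInjective (toL2 q) (toL2_injective q) D).symm.toLinearMap)

theorem restrictedOperator_apply (q : ℝ → ℝ) (D : Submodule ℂ (maxDomain q)) (y : maxDomain q)
    (hy : y ∈ D) :
    restrictedOperator q D ⟨toL2 q y, Submodule.mem_map_of_mem hy⟩ = tauL2 q y := by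
  have h : (⟨toL2 q y, Submodule.mem_map_of_mem hy⟩ : D.map (toL2 q)) =
      Submodule.equivMapOfInjective (toL2 q) (toL2_injective q) D ⟨y, hy⟩ := rfl
  change tauL2 q (((Submodule.equivMapOfInjective (toL2 q) (toL2_injective q) D).symm
    ⟨toL2 q y, Submodule.mem_map_of_mem hy⟩ : D) : maxDomain q) = tauL2 q y
  rw [h, LinearEquiv.symm_apply_apply]

/-! ### Boundary values and two-dimensional extensions -/

/-- The boundary values of `f` are `(α₁(f), α₂(f)) = (a 0, a 1)` at `-∞` and
`(β₁(f), β₂(f)) = (b 0, b 1)` at `+∞`, where `α_j(f) = [w_j, f]_{-∞}` and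
`β_j(f) = [w_j, f]_{∞}`. -/
structure HasBoundaryValues (w₁ w₂ f : ℝ → ℂ) (a b : Fin 2 → ℂ) : Prop where
  alpha_one : Tendsto (bracket w₁ f) atBot (𝓝 (a 0))
  alpha_two : Tendsto (bracket w₂ f) atBot (𝓝 (a 1))
  beta_one : Tendsto (bracket w₁ f) atTop (𝓝 (b 0))
  beta_two : Tendsto (bracket w₂ f) atTop (𝓝 (b 1))

theorem bracket_add (w : ℝ → ℂ) {f g : ℝ → ℂ} (hf : Differentiable ℝ f)
    (hg : Differentiable ℝ g) : bracket w (f + g) = bracket w f + bracket w g := by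
  ext x
  have h : deriv (f + g) x = deriv f x + deriv g x := deriv_add (hf x) (hg x)
  simp only [bracket, h, Pi.add_apply]
  ring

theorem bracket_smul (w : ℝ → ℂ) (c : ℂ) {f : ℝ → ℂ} (hf : Differentiable ℝ f) :
    bracket w (c • f) = c • bracket w f := by
  ext x
  have h : deriv (c • f) x = c • deriv f x := deriv_const_smul c (hf x)
  simp only [bracket, h, Pi.smul_apply, smul_eq_mul]
  ring

theorem bracket_zero (w : ℝ → ℂ) : bracket w 0 = 0 := by
  have h : deriv (0 : ℝ → ℂ) = 0 := by
    ext x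
    exact deriv_const x (0 : ℂ)
  ext x
  simp [bracket, h]

/-- The functions in the maximal domain whose boundary values `((α₁, α₂), (β₁, β₂))` lie in the
linear subspace `S` of `ℂ² × ℂ²`. -/
def boundaryDomain (q : ℝ → ℝ) (w₁ w₂ : ℝ → ℂ)
    (S : Submodule ℂ ((Fin 2 → ℂ) × (Fin 2 → ℂ))) : Submodule ℂ (maxDomain q) where
  carrier := {f | ∃ p ∈ S, HasBoundaryValues w₁ w₂ f p.1 p.2}
  zero_mem' := by
    refine ⟨0, S.zero_mem, ?_⟩
    constructor <;> (simp only [Submodule.coe_zero, bracket_zero]; exact tendsto_const_nhds)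
  add_mem' := by
    rintro f g ⟨p, hp, hf⟩ ⟨r, hr, hg⟩
    have hfd := f.2.1.differentiable
    have hgd := g.2.1.differentiable
    refine ⟨p + r, S.add_mem hp hr, ?_⟩
    constructor <;> simp only [Submodule.coe_add, bracket_add _ hfd hgd]
    · exact hf.alpha_one.add hg.alpha_one
    · exact hf.alpha_two.add hg.alpha_two
    · exact hf.beta_one.add hg.beta_one
    · exact hf.beta_two.add hg.beta_two
  smul_mem' := by
    rintro c f ⟨p, hp, hf⟩
    have hfd := f.2.1.differentiable
    refine ⟨c • p, S.smul_mem c hp, ?_⟩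
    constructor <;> simp only [Submodule.coe_smul, bracket_smul _ c hfd]
    · exact hf.alpha_one.const_smul c
    · exact hf.alpha_two.const_smul c
    · exact hf.beta_one.const_smul c
    · exact hf.beta_two.const_smul c

/-- Separated boundary conditions `α₁ ξ cos α - α₂ sin α = 0`, `β₁ η cos β - β₂ sin β = 0`. -/
def separatedCondition (ξ η : ℂ) (α β : ℝ) : Submodule ℂ ((Fin 2 → ℂ) × (Fin 2 → ℂ)) where
  carrier := {p | p.1 0 * ξ * (Real.cos α : ℂ) - p.1 1 * (Real.sin α : ℂ) = 0 ∧
    p.2 0 * η * (Real.cos β : ℂ) - p.2 1 * (Real.sin β : ℂ) = 0}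
  zero_mem' := by simp
  add_mem' := by
    rintro p r ⟨h1, h2⟩ ⟨h3, h4⟩
    constructor
    · simp only [Prod.fst_add, Pi.add_apply]
      linear_combination h1 + h3
    · simp only [Prod.snd_add, Pi.add_apply]
      linear_combination h2 + h4
  smul_mem' := by
    rintro c p ⟨h1, h2⟩
    constructor
    · simp only [Prod.smul_fst, Pi.smul_apply, smul_eq_mul]
      linear_combination c * h1
    · simp only [Prod.smul_snd, Pi.smul_apply, smul_eq_mul]
      linear_combination c * h2

/-- Mixed boundary conditions `(α₁, α₂)ᵀ = M (β₁, β₂)ᵀ`. -/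
def mixedConditionLeft (M : Matrix (Fin 2) (Fin 2) ℂ) :
    Submodule ℂ ((Fin 2 → ℂ) × (Fin 2 → ℂ)) where
  carrier := {p | p.1 = M.mulVec p.2}
  zero_mem' := (Matrix.mulVec_zero M).symm
  add_mem' := by
    rintro p r hp hr
    simp only [Set.mem_ofPred_eq] at hp hr ⊢
    rw [Prod.fst_add, Prod.snd_add, Matrix.mulVec_add, hp, hr]
  smul_mem' := by
    rintro c p hp
    simp only [Set.mem_ofPred_eq] at hp ⊢
    rw [Prod.smul_fst, Prod.smul_snd, Matrix.mulVec_smul, hp]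

/-- Mixed boundary conditions `(β₁, β₂)ᵀ = M (α₁, α₂)ᵀ`. -/
def mixedConditionRight (M : Matrix (Fin 2) (Fin 2) ℂ) :
    Submodule ℂ ((Fin 2 → ℂ) × (Fin 2 → ℂ)) where
  carrier := {p | p.2 = M.mulVec p.1}
  zero_mem' := (Matrix.mulVec_zero M).symm
  add_mem' := by
    rintro p r hp hr
    simp only [Set.mem_ofPred_eq] at hp hr ⊢
    rw [Prod.fst_add, Prod.snd_add, Matrix.mulVec_add, hp, hr]
  smul_mem' := by
    rintro c p hp
    simp only [Set.mem_ofPred_eq] at hp ⊢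
    rw [Prod.smul_fst, Prod.smul_snd, Matrix.mulVec_smul, hp]

/-- The restriction of the maximal operator defined by the boundary condition `S`. -/
def extensionOf (q : ℝ → ℝ) (w₁ w₂ : ℝ → ℂ)
    (S : Submodule ℂ ((Fin 2 → ℂ) × (Fin 2 → ℂ))) : L2 →ₗ.[ℂ] L2 :=
  restrictedOperator q (boundaryDomain q w₁ w₂ S)

/-! ### Parity and self-adjointness with respect to it -/

/-- The parity operator `(P f)(x) = f(-x)` on `L²(ℝ)`. -/
def parity : L2 →ₗᵢ[ℂ] L2 :=
  Lp.compMeasurePreservingₗᵢ ℂ (fun x : ℝ => -x) (Measure.measurePreserving_neg volume)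

/-- A closed densely defined operator `H` in `L²(ℝ)` is `P`-self-adjoint if
`dom H = dom (H* P) = {f | P f ∈ dom H*}` and `H f = P H* P f` for all `f ∈ dom H`. -/
def IsPSelfAdjoint (H : L2 →ₗ.[ℂ] L2) : Prop :=
  Dense (H.domain : Set L2) ∧ H.IsClosed ∧
    (∀ f : L2, f ∈ H.domain ↔ parity f ∈ H.adjoint.domain) ∧
    ∀ (f : H.domain) (g : H.adjoint.domain), (g : L2) = parity (f : L2) →
      H f = parity (H.adjoint g)

end PTSL

end

/-!
Green's formula expresses `⟪A_max f, g⟫ - ⟪f, A_max g⟫` through the brackets `[f, g]_{±∞}`, and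
since `w₁`, `w₂` have Wronskian `1`, the bracket `[f, g]` is a fixed sesquilinear form in the
brackets of `f` and of `g` with `w₁`, `w₂`. In the limit circle case both solutions are square
integrable, so variation of constants shows that the boundary values exhaust `ℂ² × ℂ²` and that a
vector in the domain of an adjoint comes from the maximal domain. Hence the adjoint of the extension
with boundary condition `S` is the extension whose boundary condition is the orthogonal complement
of `S` for the form in Green's formula.

Since `q` and `w₂` are even and `w₁` is odd, the reflection `x ↦ -x` acts on boundary values by
swapping the two ends and changing the sign of the second component. So `P H* P` is again an
extension, whose boundary condition depends on `S` alone, and `P`-self-adjointness says that `S`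
coincides with it: an equation between subspaces of `ℂ² × ℂ²`.
-/

noncomputable section

namespace PTSL

/-! ### Absolutely continuous functions -/

theorem absolutelyContinuousOnInterval_of_dist_le {X Y : Type*} [PseudoMetricSpace X]
    [PseudoMetricSpace Y] {f : ℝ → X} {g : ℝ → Y} {a b : ℝ}
    (hg : AbsolutelyContinuousOnInterval g a b) (h : ∀ x y, dist (f x) (f y) ≤ dist (g x) (g y)) :
    AbsolutelyContinuousOnInterval f a b :=
  squeeze_zero (fun _ => Finset.sum_nonneg fun _ _ => dist_nonneg)
    (fun _ => Finset.sum_le_sum fun _ _ => h _ _) hg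

theorem disjoint_uIoc_neg_iff {a b c d : ℝ} :
    Disjoint (Set.uIoc (-a) (-b)) (Set.uIoc (-c) (-d)) ↔
      Disjoint (Set.uIoc a b) (Set.uIoc c d) := by
  simp only [Set.uIoc, Set.Ioc_disjoint_Ioc, min_neg_neg, max_neg_neg, neg_le_neg_iff]

theorem absolutelyContinuousOnInterval_comp_neg {X : Type*} [PseudoMetricSpace X] {f : ℝ → X}
    {a b : ℝ} (hf : AbsolutelyContinuousOnInterval f (-a) (-b)) :
    AbsolutelyContinuousOnInterval (fun x => f (-x)) a b := by
  rw [absolutelyContinuousOnInterval_iff] at hf ⊢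
  intro ε hε
  obtain ⟨δ, hδ, h⟩ := hf ε hε
  refine ⟨δ, hδ, fun E hE hlength => h (E.1, fun i => (-(E.2 i).1, -(E.2 i).2)) ⟨?_, ?_⟩ ?_⟩
  · intro i hi
    simpa only [← Set.neg_uIcc, Set.mem_neg, neg_neg] using hE.1 i hi
  · intro i hi j hj hij
    exact disjoint_uIoc_neg_iff.2 (hE.2 hi hj hij)
  · simpa only [dist_neg_neg] using hlength

theorem intervalIntegrable_of_locallyIntegrable {E : Type*} [NormedAddCommGroup E] {g : ℝ → E}
    (hg : LocallyIntegrable g volume) (a b : ℝ) : IntervalIntegrable g volume a b :=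
  (hg.integrableOn_isCompact isCompact_uIcc).intervalIntegrable

theorem acLoc_intervalIntegral {g : ℝ → ℂ} (hg : LocallyIntegrable g volume) (c : ℝ) :
    ACLoc (fun x => ∫ t in c..x, g t) := by
  intro a b
  have hint := intervalIntegrable_of_locallyIntegrable hg
  have hnorm : AbsolutelyContinuousOnInterval (fun x => ∫ t in a..x, ‖g t‖) a b :=
    (hint a b).norm.absolutelyContinuousOnInterval_intervalIntegral Set.left_mem_uIcc
  refine absolutelyContinuousOnInterval_of_dist_le hnorm fun x y => ?_
  rw [dist_eq_norm, Real.dist_eq, intervalIntegral.integral_interval_sub_left (hint c x) (hint c y),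
    intervalIntegral.integral_interval_sub_left (hint a x).norm (hint a y).norm]
  exact intervalIntegral.norm_integral_le_abs_integral_norm

namespace ACLoc

variable {f g : ℝ → ℂ}

theorem mul (hf : ACLoc f) (hg : ACLoc g) : ACLoc (fun x => f x * g x) :=
  fun a b => (hf a b).smul (hg a b)

theorem add (hf : ACLoc f) (hg : ACLoc g) : ACLoc (fun x => f x + g x) :=
  fun a b => AbsolutelyContinuousOnInterval.add (hf a b) (hg a b)

theorem sub (hf : ACLoc f) (hg : ACLoc g) : ACLoc (fun x => f x - g x) :=
  fun a b => AbsolutelyContinuousOnInterval.sub (hf a b) (hg a b)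

theorem neg (hf : ACLoc f) : ACLoc (fun x => -f x) :=
  fun a b => AbsolutelyContinuousOnInterval.neg (hf a b)

theorem const (c : ℂ) : ACLoc (fun _ => c) := fun _ _ =>
  (LipschitzWith.const c).lipschitzOnWith.absolutelyContinuousOnInterval

theorem conj (hf : ACLoc f) : ACLoc (fun x => (starRingEnd ℂ) (f x)) := fun a b =>
  absolutelyContinuousOnInterval_of_dist_le (hf a b) fun _ _ => (Complex.dist_conj_conj _ _).le

theorem comp_neg (hf : ACLoc f) : ACLoc (fun x => f (-x)) := fun a b =>
  absolutelyContinuousOnInterval_comp_neg (hf (-a) (-b))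

theorem integral_eq_sub (hf : ACLoc f) (hg : LocallyIntegrable g volume)
    (hfg : ∀ᵐ x : ℝ, HasDerivAt f (g x) x) (a b : ℝ) : ∫ t in a..b, g t = f b - f a := by
  obtain ⟨C, hC⟩ := (hf.sub (acLoc_intervalIntegral hg a) a b).const_of_ae_hasDerivAt_zero (by
    filter_upwards [hfg, LocallyIntegrable.ae_hasDerivAt_integral hg] with x h1 h2 _
    simpa only [sub_self] using h1.fun_sub (h2 a))
  have ha : f a - ∫ t in a..a, g t = C := hC a Set.left_mem_uIcc
  have hb : f b - ∫ t in a..b, g t = C := hC b Set.right_mem_uIcc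
  rw [intervalIntegral.integral_same] at ha
  linear_combination ha - hb

theorem hasDerivAt_of_continuous (hf : ACLoc f) (hg : Continuous g)
    (hfg : ∀ᵐ x : ℝ, HasDerivAt f (g x) x) (x : ℝ) : HasDerivAt f (g x) x := by
  have hprimitive : f = fun x => f 0 + ∫ t in (0 : ℝ)..x, g t := by
    ext y
    rw [hf.integral_eq_sub hg.locallyIntegrable hfg, add_sub_cancel]
  rw [hprimitive]
  exact (hg.integral_hasStrictDerivAt 0 x).hasDerivAt.const_add (f 0)

theorem exists_tendsto_of_integrable (hf : ACLoc f) (hg : Integrable g volume)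
    (hfg : ∀ᵐ x : ℝ, HasDerivAt f (g x) x) :
    ∃ l r : ℂ, Tendsto f atBot (𝓝 l) ∧ Tendsto f atTop (𝓝 r) ∧ r - l = ∫ x, g x := by
  have hFTC := hf.integral_eq_sub hg.locallyIntegrable hfg
  have hbot := intervalIntegral_tendsto_integral_Iic 0 hg.integrableOn tendsto_id
  have htop := intervalIntegral_tendsto_integral_Ioi 0 hg.integrableOn tendsto_id
  refine ⟨_, _, (hbot.const_sub (f 0)).congr fun x => ?_, (htop.const_add (f 0)).congr fun x => ?_,
    ?_⟩
  · rw [id, hFTC, sub_sub_cancel]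
  · rw [id, hFTC, add_sub_cancel]
  · rw [← intervalIntegral.integral_Iic_add_Ioi hg.integrableOn (hg.integrableOn (s := Set.Ioi 0))]
    ring

end ACLoc

section IntegralIic

variable {E : Type*} [NormedAddCommGroup E] [NormedSpace ℝ E] {g : ℝ → E}

theorem integral_Iic_eq_add_intervalIntegral (hg : Integrable g volume) (x : ℝ) :
    ∫ t in Set.Iic x, g t = (∫ t in Set.Iic (0 : ℝ), g t) + ∫ t in (0 : ℝ)..x, g t := by
  rw [← intervalIntegral.integral_Iic_sub_Iic hg.integrableOn hg.integrableOn, add_sub_cancel]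

theorem ae_hasDerivAt_integral_Iic [CompleteSpace E] (hg : Integrable g volume) :
    ∀ᵐ x : ℝ, HasDerivAt (fun x => ∫ t in Set.Iic x, g t) (g x) x := by
  rw [funext (integral_Iic_eq_add_intervalIntegral hg)]
  filter_upwards [LocallyIntegrable.ae_hasDerivAt_integral hg.locallyIntegrable] with x hx
  exact (hx 0).const_add _

theorem norm_integral_Iic_le (hg : Integrable g volume) (x : ℝ) :
    ‖∫ t in Set.Iic x, g t‖ ≤ ∫ t, ‖g t‖ :=
  (norm_integral_le_integral_norm _).trans
    (setIntegral_le_integral hg.norm (Eventually.of_forall fun _ => norm_nonneg _))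

theorem tendsto_integral_Iic_atTop (hg : Integrable g volume) :
    Tendsto (fun x => ∫ t in Set.Iic x, g t) atTop (𝓝 (∫ t, g t)) :=
  (aecover_Iic tendsto_id).integral_tendsto_of_countably_generated hg

end IntegralIic

theorem acLoc_integral_Iic {g : ℝ → ℂ} (hg : Integrable g volume) :
    ACLoc (fun x => ∫ t in Set.Iic x, g t) := by
  rw [funext (integral_Iic_eq_add_intervalIntegral hg)]
  exact (ACLoc.const _).add (acLoc_intervalIntegral hg.locallyIntegrable 0)

/-! ### Brackets and Green's formula -/

open scoped ComplexConjugate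

theorem IsRegular.ae_hasDerivAt_deriv {f : ℝ → ℂ} (hf : IsRegular f) :
    ∀ᵐ x : ℝ, HasDerivAt (deriv f) (deriv (deriv f) x) x :=
  hf.acLoc_deriv.ae_differentiableAt.mono fun _ hx => hx.hasDerivAt

theorem acLoc_bracket {f g : ℝ → ℂ} (hf : IsRegular f) (hg : IsRegular g) :
    ACLoc (bracket f g) :=
  (hf.acLoc.conj.mul hg.acLoc_deriv).sub (hf.acLoc_deriv.conj.mul hg.acLoc)

theorem ae_hasDerivAt_bracket (q : ℝ → ℝ) {f g : ℝ → ℂ} (hf : IsRegular f) (hg : IsRegular g) :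
    ∀ᵐ x : ℝ, HasDerivAt (bracket f g) (conj (tau q f x) * g x - conj (f x) * tau q g x) x := by
  filter_upwards [hf.ae_hasDerivAt_deriv, hg.ae_hasDerivAt_deriv] with x hf' hg'
  refine (((hf.differentiable x).hasDerivAt.star.fun_mul hg').fun_sub
    (hf'.star.fun_mul (hg.differentiable x).hasDerivAt)).congr_deriv ?_
  simp only [tau, map_sub, map_neg, map_mul, ← starRingEnd_apply, Complex.conj_ofReal]
  ring

theorem conj_bracket (f g : ℝ → ℂ) (x : ℝ) : conj (bracket f g x) = -bracket g f x := by
  simp only [bracket, map_sub, map_mul, Complex.conj_conj]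
  ring

theorem bracket_eq_of_real {w : ℝ → ℂ} (hw : ∀ x, (w x).im = 0) (f : ℝ → ℂ) (x : ℝ) :
    bracket w f x = w x * deriv f x - deriv w x * f x := by
  have hconj : (fun x => star (w x)) = w := funext fun x => Complex.conj_eq_iff_im.2 (hw x)
  have hderiv : conj (deriv w x) = deriv w x := by
    conv_rhs => rw [← hconj, deriv.star]
    rfl
  rw [bracket, Complex.conj_eq_iff_im.2 (hw x), hderiv]

theorem integrable_conj_mul {X : Type*} [MeasurableSpace X] {μ : Measure X} {f g : X → ℂ}
    (hf : MemLp f 2 μ) (hg : MemLp g 2 μ) : Integrable (fun x => conj (f x) * g x) μ :=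
  hf.star.integrable_mul hg

theorem inner_toLp {X : Type*} [MeasurableSpace X] {μ : Measure X} {f g : X → ℂ}
    (hf : MemLp f 2 μ) (hg : MemLp g 2 μ) :
    inner ℂ (hf.toLp f) (hg.toLp g) = ∫ x, conj (f x) * g x ∂μ := by
  rw [L2.inner_def]
  refine integral_congr_ae ?_
  filter_upwards [hf.coeFn_toLp, hg.coeFn_toLp] with x hfx hgx
  rw [hfx, hgx, RCLike.inner_apply']

theorem exists_tendsto_bracket {q : ℝ → ℝ} (f g : maxDomain q) :
    ∃ l r : ℂ, Tendsto (bracket f g) atBot (𝓝 l) ∧ Tendsto (bracket f g) atTop (𝓝 r) ∧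
      inner ℂ (tauL2 q f) (toL2 q g) - inner ℂ (toL2 q f) (tauL2 q g) = r - l := by
  have htf := integrable_conj_mul f.2.2.2 g.2.2.1
  have htg := integrable_conj_mul f.2.2.1 g.2.2.2
  obtain ⟨l, r, hl, hr, hlr⟩ := (acLoc_bracket f.2.1 g.2.1).exists_tendsto_of_integrable
    (htf.sub htg) (ae_hasDerivAt_bracket q f.2.1 g.2.1)
  refine ⟨l, r, hl, hr, ?_⟩
  rw [hlr]
  exact (congrArg₂ (· - ·) (inner_toLp f.2.2.2 g.2.2.1) (inner_toLp f.2.2.1 g.2.2.2)).trans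
    (integral_sub htf htg).symm

/-! ### Real fundamental systems in the maximal domain -/

theorem memLp_two_of_continuous {f : ℝ → ℂ} (hf : Continuous f) {a b : ℝ}
    (ha : MemLp f 2 (volume.restrict (Set.Iio a))) (hb : MemLp f 2 (volume.restrict (Set.Ioi b))) :
    MemLp f 2 volume := by
  rw [memLp_two_iff_integrable_sq_norm hf.aestronglyMeasurable] at ha hb ⊢
  rw [integrable_iff_integrableAtFilter_atBot_atTop]
  exact ⟨⟨⟨_, Iio_mem_atBot a, ha⟩, ⟨_, Ioi_mem_atTop b, hb⟩⟩, (hf.norm.pow 2).locallyIntegrable⟩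

theorem IsSolution.tau_ae_eq_zero {q : ℝ → ℝ} {w : ℝ → ℂ} (hw : IsSolution q 0 w) :
    tau q w =ᵐ[volume] 0 :=
  hw.2.mono fun x hx => by rw [hx, zero_mul, Pi.zero_apply]

theorem IsSolution.mem_maxDomain {q : ℝ → ℝ} {w : ℝ → ℂ} (hw : IsSolution q 0 w)
    (htop : LimitCircleAtTop q) (hbot : LimitCircleAtBot q) : w ∈ maxDomain q :=
  let ⟨_, ha⟩ := hbot 0 w hw
  let ⟨_, hb⟩ := htop 0 w hw
  ⟨hw.1, memLp_two_of_continuous hw.1.acLoc.continuous ha hb,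
    (memLp_congr_ae hw.tau_ae_eq_zero).2 MemLp.zero⟩

theorem tauL2_eq_zero {q : ℝ → ℝ} {w : maxDomain q} (hw : IsSolution q 0 w) : tauL2 q w = 0 :=
  (MemLp.toLp_eq_toLp_iff w.2.2.2 MemLp.zero).2 hw.tau_ae_eq_zero

theorem IsSolution.bracket_eq_of_tendsto {q : ℝ → ℝ} {u v : ℝ → ℂ} (hu : IsSolution q 0 u)
    (hv : IsSolution q 0 v) {c : ℂ} (hc : Tendsto (bracket u v) atTop (𝓝 c)) (x : ℝ) :
    bracket u v x = c := by
  have hderiv : ∀ᵐ x : ℝ, HasDerivAt (bracket u v) 0 x := by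
    filter_upwards [ae_hasDerivAt_bracket q hu.1 hv.1, hu.tau_ae_eq_zero, hv.tau_ae_eq_zero]
      with x h hux hvx
    simpa only [hux, hvx, Pi.zero_apply, map_zero, zero_mul, mul_zero, sub_zero] using h
  have hconst (y : ℝ) : bracket u v x = bracket u v y := by
    have h := (acLoc_bracket hu.1 hv.1).integral_eq_sub (g := fun _ => 0)
      (locallyIntegrable_const 0) hderiv y x
    rwa [intervalIntegral.integral_zero, eq_comm, sub_eq_zero] at h
  exact tendsto_nhds_unique (tendsto_const_nhds.congr hconst) hc

/-- A pair of real-valued solutions of `τ_q y = 0` that are square integrable on the whole line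
and have Wronskian `1`. Unlike in `IsNormalizedPair`, the solutions need not be odd or
even. -/
structure IsRealFundamentalSystem {q : ℝ → ℝ} (w₁ w₂ : maxDomain q) : Prop where
  solution_fst : IsSolution q 0 w₁
  solution_snd : IsSolution q 0 w₂
  real_fst : ∀ x, ((w₁ : ℝ → ℂ) x).im = 0
  real_snd : ∀ x, ((w₂ : ℝ → ℂ) x).im = 0
  bracket_eq_one : ∀ x, bracket w₁ w₂ x = 1

theorem IsNormalizedPair.isRealFundamentalSystem {q : ℝ → ℝ} {w₁ w₂ : maxDomain q}
    (hw : IsNormalizedPair q w₁ w₂) : IsRealFundamentalSystem w₁ w₂ where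
  solution_fst := hw.solution_fst
  solution_snd := hw.solution_snd
  real_fst := hw.real_fst
  real_snd := hw.real_snd
  bracket_eq_one := hw.solution_fst.bracket_eq_of_tendsto hw.solution_snd hw.bracket_atTop

namespace IsRealFundamentalSystem

variable {q : ℝ → ℝ} {w₁ w₂ : maxDomain q} (hw : IsRealFundamentalSystem w₁ w₂)
include hw

theorem conj_fst (x : ℝ) : conj ((w₁ : ℝ → ℂ) x) = (w₁ : ℝ → ℂ) x :=
  Complex.conj_eq_iff_im.2 (hw.real_fst x)

theorem conj_snd (x : ℝ) : conj ((w₂ : ℝ → ℂ) x) = (w₂ : ℝ → ℂ) x :=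
  Complex.conj_eq_iff_im.2 (hw.real_snd x)

theorem bracket_fst (f : ℝ → ℂ) (x : ℝ) :
    bracket w₁ f x = (w₁ : ℝ → ℂ) x * deriv f x - deriv (w₁ : ℝ → ℂ) x * f x :=
  bracket_eq_of_real hw.real_fst f x

theorem bracket_snd (f : ℝ → ℂ) (x : ℝ) :
    bracket w₂ f x = (w₂ : ℝ → ℂ) x * deriv f x - deriv (w₂ : ℝ → ℂ) x * f x :=
  bracket_eq_of_real hw.real_snd f x

theorem wronskian (x : ℝ) :
    (w₁ : ℝ → ℂ) x * deriv (w₂ : ℝ → ℂ) x - deriv (w₁ : ℝ → ℂ) x * (w₂ : ℝ → ℂ) x = 1 := by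
  rw [← hw.bracket_fst, hw.bracket_eq_one]

theorem bracket_eq (f g : ℝ → ℂ) (x : ℝ) :
    bracket f g x =
      conj (bracket w₁ f x) * bracket w₂ g x - conj (bracket w₂ f x) * bracket w₁ g x := by
  rw [conj_bracket, conj_bracket, hw.bracket_fst, hw.bracket_snd, bracket, bracket, bracket]
  linear_combination
    (conj (deriv f x) * g x - conj (f x) * deriv g x) * hw.wronskian x

end IsRealFundamentalSystem

/-! ### Variation of constants -/

/-- The inner product of `w` and `g` over the half-line `(-∞, x]`, as a function of `x`. -/
def innerIic (w g : ℝ → ℂ) (x : ℝ) : ℂ :=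
  ∫ t in Set.Iic x, conj (w t) * g t

/-- The solution of `τ_q y = g` obtained from a real fundamental system `w₁`, `w₂` of
`τ_q y = 0` by variation of constants, with both coefficients vanishing at `-∞`. -/
def particularSolution (w₁ w₂ g : ℝ → ℂ) (x : ℝ) : ℂ :=
  w₁ x * innerIic w₂ g x - w₂ x * innerIic w₁ g x

section InnerIic

variable {w g : ℝ → ℂ} (hw : MemLp w 2 volume) (hg : MemLp g 2 volume)
include hw hg

theorem acLoc_innerIic : ACLoc (innerIic w g) :=
  acLoc_integral_Iic (integrable_conj_mul hw hg)

theorem ae_hasDerivAt_innerIic : ∀ᵐ x, HasDerivAt (innerIic w g) (conj (w x) * g x) x :=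
  ae_hasDerivAt_integral_Iic (integrable_conj_mul hw hg)

theorem memLp_mul_innerIic {v : ℝ → ℂ} (hv : MemLp v 2 volume) :
    MemLp (fun x => v x * innerIic w g x) 2 volume := by
  refine hv.of_le_mul (c := ∫ t, ‖conj (w t) * g t‖)
    (hv.1.mul (acLoc_innerIic hw hg).continuous.aestronglyMeasurable)
    (Eventually.of_forall fun x => ?_)
  rw [norm_mul, mul_comm]
  gcongr
  exact norm_integral_Iic_le (integrable_conj_mul hw hg) x

theorem tendsto_innerIic_atTop :
    Tendsto (innerIic w g) atTop (𝓝 (inner ℂ (hw.toLp w) (hg.toLp g))) := by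
  rw [inner_toLp]
  exact tendsto_integral_Iic_atTop (integrable_conj_mul hw hg)

end InnerIic

theorem tendsto_innerIic_atBot (w g : ℝ → ℂ) : Tendsto (innerIic w g) atBot (𝓝 0) :=
  tendsto_integral_Iic_zero tendsto_id

namespace IsRealFundamentalSystem

variable {q : ℝ → ℝ} {w₁ w₂ : maxDomain q} (hw : IsRealFundamentalSystem w₁ w₂)
  {g : ℝ → ℂ} (hg : MemLp g 2 volume)
include hw hg

theorem hasDerivAt_particularSolution (x : ℝ) :
    HasDerivAt (particularSolution w₁ w₂ g)
      (deriv (w₁ : ℝ → ℂ) x * innerIic w₂ g x - deriv (w₂ : ℝ → ℂ) x * innerIic w₁ g x) x := by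
  have hI₁ := acLoc_innerIic w₁.2.2.1 hg
  have hI₂ := acLoc_innerIic w₂.2.2.1 hg
  refine ((w₁.2.1.acLoc.mul hI₂).sub (w₂.2.1.acLoc.mul hI₁)).hasDerivAt_of_continuous
    (g := fun x => deriv (w₁ : ℝ → ℂ) x * innerIic w₂ g x - deriv (w₂ : ℝ → ℂ) x * innerIic w₁ g x)
    ((w₁.2.1.acLoc_deriv.mul hI₂).sub (w₂.2.1.acLoc_deriv.mul hI₁)).continuous ?_ x
  filter_upwards [ae_hasDerivAt_innerIic w₁.2.2.1 hg, ae_hasDerivAt_innerIic w₂.2.2.1 hg]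
    with x hI₁' hI₂'
  refine (((w₁.2.1.differentiable x).hasDerivAt.fun_mul hI₂').fun_sub
    ((w₂.2.1.differentiable x).hasDerivAt.fun_mul hI₁')).congr_deriv ?_
  rw [hw.conj_fst, hw.conj_snd]
  ring

theorem deriv_particularSolution :
    deriv (particularSolution w₁ w₂ g) = fun x =>
      deriv (w₁ : ℝ → ℂ) x * innerIic w₂ g x - deriv (w₂ : ℝ → ℂ) x * innerIic w₁ g x :=
  deriv_eq (hw.hasDerivAt_particularSolution hg)

theorem isRegular_particularSolution : IsRegular (particularSolution w₁ w₂ g) where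
  differentiable x := (hw.hasDerivAt_particularSolution hg x).differentiableAt
  acLoc := (w₁.2.1.acLoc.mul (acLoc_innerIic w₂.2.2.1 hg)).sub
    (w₂.2.1.acLoc.mul (acLoc_innerIic w₁.2.2.1 hg))
  acLoc_deriv := by
    rw [hw.deriv_particularSolution hg]
    exact (w₁.2.1.acLoc_deriv.mul (acLoc_innerIic w₂.2.2.1 hg)).sub
      (w₂.2.1.acLoc_deriv.mul (acLoc_innerIic w₁.2.2.1 hg))

theorem tau_particularSolution : tau q (particularSolution w₁ w₂ g) =ᵐ[volume] g := by
  filter_upwards [ae_hasDerivAt_innerIic w₁.2.2.1 hg, ae_hasDerivAt_innerIic w₂.2.2.1 hg,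
    w₁.2.1.ae_hasDerivAt_deriv, w₂.2.1.ae_hasDerivAt_deriv, hw.solution_fst.tau_ae_eq_zero,
    hw.solution_snd.tau_ae_eq_zero] with x hI₁' hI₂' hw₁'' hw₂'' hτ₁ hτ₂
  have hderiv₂ := ((hw₁''.fun_mul hI₂').fun_sub (hw₂''.fun_mul hI₁')).deriv
  rw [tau, hw.deriv_particularSolution hg, hderiv₂, hw.conj_fst, hw.conj_snd, particularSolution]
  simp only [tau, Pi.zero_apply] at hτ₁ hτ₂
  linear_combination innerIic w₂ g x * hτ₁ - innerIic w₁ g x * hτ₂ + g x * hw.wronskian x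

theorem particularSolution_mem_maxDomain : particularSolution w₁ w₂ g ∈ maxDomain q :=
  ⟨hw.isRegular_particularSolution hg,
    (memLp_mul_innerIic w₂.2.2.1 hg w₁.2.2.1).sub (memLp_mul_innerIic w₁.2.2.1 hg w₂.2.2.1),
    (memLp_congr_ae (hw.tau_particularSolution hg)).2 hg⟩

theorem bracket_fst_particularSolution :
    bracket w₁ (particularSolution w₁ w₂ g) = -innerIic w₁ g := by
  ext x
  rw [hw.bracket_fst, hw.deriv_particularSolution hg, particularSolution, Pi.neg_apply]
  linear_combination -innerIic w₁ g x * hw.wronskian x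

theorem bracket_snd_particularSolution :
    bracket w₂ (particularSolution w₁ w₂ g) = -innerIic w₂ g := by
  ext x
  rw [hw.bracket_snd, hw.deriv_particularSolution hg, particularSolution, Pi.neg_apply]
  linear_combination -innerIic w₂ g x * hw.wronskian x

end IsRealFundamentalSystem

/-! ### Boundary values -/

section BracketLimits

variable {q : ℝ → ℝ}

theorem tendsto_limUnder_bracket_atBot (f g : maxDomain q) :
    Tendsto (bracket f g) atBot (𝓝 (limUnder atBot (bracket f g))) :=
  let ⟨l, _, hl, _⟩ := exists_tendsto_bracket f g
  tendsto_nhds_limUnder ⟨l, hl⟩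

theorem tendsto_limUnder_bracket_atTop (f g : maxDomain q) :
    Tendsto (bracket f g) atTop (𝓝 (limUnder atTop (bracket f g))) :=
  let ⟨_, r, _, hr, _⟩ := exists_tendsto_bracket f g
  tendsto_nhds_limUnder ⟨r, hr⟩

/-- The bracket `[f, ·]_{-∞}` as a linear form on the maximal domain. -/
def bracketAtBot (f : maxDomain q) : maxDomain q →ₗ[ℂ] ℂ where
  toFun g := limUnder atBot (bracket f g)
  map_add' g h := by
    rw [Submodule.coe_add, bracket_add _ g.2.1.differentiable h.2.1.differentiable]
    exact ((tendsto_limUnder_bracket_atBot f g).add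
      (tendsto_limUnder_bracket_atBot f h)).limUnder_eq
  map_smul' c g := by
    rw [Submodule.coe_smul, bracket_smul _ c g.2.1.differentiable]
    exact ((tendsto_limUnder_bracket_atBot f g).const_smul c).limUnder_eq

/-- The bracket `[f, ·]_{∞}` as a linear form on the maximal domain. -/
def bracketAtTop (f : maxDomain q) : maxDomain q →ₗ[ℂ] ℂ where
  toFun g := limUnder atTop (bracket f g)
  map_add' g h := by
    rw [Submodule.coe_add, bracket_add _ g.2.1.differentiable h.2.1.differentiable]
    exact ((tendsto_limUnder_bracket_atTop f g).add
      (tendsto_limUnder_bracket_atTop f h)).limUnder_eq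
  map_smul' c g := by
    rw [Submodule.coe_smul, bracket_smul _ c g.2.1.differentiable]
    exact ((tendsto_limUnder_bracket_atTop f g).const_smul c).limUnder_eq

theorem tendsto_bracketAtBot (f g : maxDomain q) :
    Tendsto (bracket f g) atBot (𝓝 (bracketAtBot f g)) :=
  tendsto_limUnder_bracket_atBot f g

theorem tendsto_bracketAtTop (f g : maxDomain q) :
    Tendsto (bracket f g) atTop (𝓝 (bracketAtTop f g)) :=
  tendsto_limUnder_bracket_atTop f g

theorem inner_tauL2_sub_inner_tauL2 (f g : maxDomain q) :
    inner ℂ (tauL2 q f) (toL2 q g) - inner ℂ (toL2 q f) (tauL2 q g) =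
      bracketAtTop f g - bracketAtBot f g := by
  obtain ⟨l, r, hl, hr, hlr⟩ := exists_tendsto_bracket f g
  rw [hlr, tendsto_nhds_unique (tendsto_bracketAtBot f g) hl,
    tendsto_nhds_unique (tendsto_bracketAtTop f g) hr]

end BracketLimits

/-- The space of boundary values `((α₁, α₂), (β₁, β₂))`, the first component belonging to `-∞`
and the second one to `+∞`. -/
abbrev BoundarySpace : Type := (Fin 2 → ℂ) × (Fin 2 → ℂ)

/-- The boundary values `((α₁(f), α₂(f)), (β₁(f), β₂(f)))` as a linear map of `f`. -/
def boundaryValues {q : ℝ → ℝ} (w₁ w₂ : maxDomain q) : maxDomain q →ₗ[ℂ] BoundarySpace :=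
  (LinearMap.pi ![bracketAtBot w₁, bracketAtBot w₂]).prod
    (LinearMap.pi ![bracketAtTop w₁, bracketAtTop w₂])

/-- The sesquilinear form on the space of boundary values that appears in Green's formula. -/
def boundaryForm : BoundarySpace →ₗ⋆[ℂ] BoundarySpace →ₗ[ℂ] ℂ :=
  LinearMap.mk₂'ₛₗ (starRingEnd ℂ) (RingHom.id ℂ)
    (fun p r => (conj (p.2 0) * r.2 1 - conj (p.2 1) * r.2 0) -
      (conj (p.1 0) * r.1 1 - conj (p.1 1) * r.1 0))
    (fun p p' r => by simp only [Prod.fst_add, Prod.snd_add, Pi.add_apply, map_add]; ring)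
    (fun c p r => by
      simp only [Prod.smul_fst, Prod.smul_snd, Pi.smul_apply, smul_eq_mul, map_mul]; ring)
    (fun p r r' => by simp only [Prod.fst_add, Prod.snd_add, Pi.add_apply]; ring)
    (fun c p r => by
      simp only [Prod.smul_fst, Prod.smul_snd, Pi.smul_apply, smul_eq_mul, RingHom.id_apply]; ring)

theorem boundaryForm_apply (p r : BoundarySpace) :
    boundaryForm p r = (conj (p.2 0) * r.2 1 - conj (p.2 1) * r.2 0) -
      (conj (p.1 0) * r.1 1 - conj (p.1 1) * r.1 0) := rfl

section BoundaryValues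

variable {q : ℝ → ℝ} {w₁ w₂ : maxDomain q}

theorem hasBoundaryValues_iff {f : maxDomain q} {p : BoundarySpace} :
    HasBoundaryValues w₁ w₂ f p.1 p.2 ↔ boundaryValues w₁ w₂ f = p := by
  constructor
  · intro h
    ext i <;> fin_cases i
    · exact tendsto_nhds_unique (tendsto_bracketAtBot w₁ f) h.alpha_one
    · exact tendsto_nhds_unique (tendsto_bracketAtBot w₂ f) h.alpha_two
    · exact tendsto_nhds_unique (tendsto_bracketAtTop w₁ f) h.beta_one
    · exact tendsto_nhds_unique (tendsto_bracketAtTop w₂ f) h.beta_two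
  · rintro rfl
    exact ⟨tendsto_bracketAtBot w₁ f, tendsto_bracketAtBot w₂ f, tendsto_bracketAtTop w₁ f,
      tendsto_bracketAtTop w₂ f⟩

theorem boundaryDomain_eq_comap (S : Submodule ℂ BoundarySpace) :
    boundaryDomain q w₁ w₂ S = S.comap (boundaryValues w₁ w₂) := by
  ext f
  change (∃ p ∈ S, HasBoundaryValues w₁ w₂ f p.1 p.2) ↔ boundaryValues w₁ w₂ f ∈ S
  simp only [hasBoundaryValues_iff, exists_eq_right']

end BoundaryValues

open scoped ComplexOrder in
theorem exists_forall_inner_eq_of_linearIndependent {𝕜 E ι : Type*} [RCLike 𝕜]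
    [NormedAddCommGroup E] [InnerProductSpace 𝕜 E] [Finite ι] {v : ι → E}
    (hv : LinearIndependent 𝕜 v) (c : ι → 𝕜) : ∃ g : E, ∀ i, inner 𝕜 (v i) g = c i := by
  classical
  have := Fintype.ofFinite ι
  obtain ⟨x, hx⟩ := Matrix.mulVec_surjective_iff_isUnit.2
    (Matrix.posDef_gram_of_linearIndependent hv).isUnit c
  refine ⟨∑ j, x j • v j, fun i => ?_⟩
  rw [← hx, inner_sum, Matrix.mulVec, dotProduct]
  exact Finset.sum_congr rfl fun j _ => by rw [inner_smul_right, mul_comm, Matrix.gram_apply]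

namespace IsRealFundamentalSystem

variable {q : ℝ → ℝ} {w₁ w₂ : maxDomain q} (hw : IsRealFundamentalSystem w₁ w₂)
include hw

theorem inner_tauL2_sub_inner_tauL2_eq_boundaryForm (f g : maxDomain q) :
    inner ℂ (tauL2 q f) (toL2 q g) - inner ℂ (toL2 q f) (tauL2 q g) =
      boundaryForm (boundaryValues w₁ w₂ f) (boundaryValues w₁ w₂ g) := by
  have hlim {l : Filter ℝ} {a b c d : ℂ} (ha : Tendsto (bracket w₁ f) l (𝓝 a))
      (hb : Tendsto (bracket w₂ f) l (𝓝 b)) (hc : Tendsto (bracket w₁ g) l (𝓝 c))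
      (hd : Tendsto (bracket w₂ g) l (𝓝 d)) :
      Tendsto (bracket f g) l (𝓝 (conj a * d - conj b * c)) := by
    rw [funext (hw.bracket_eq f g)]
    exact (ha.star.mul hd).sub (hb.star.mul hc)
  have hTop := hlim (tendsto_bracketAtTop w₁ f) (tendsto_bracketAtTop w₂ f)
    (tendsto_bracketAtTop w₁ g) (tendsto_bracketAtTop w₂ g)
  have hBot := hlim (tendsto_bracketAtBot w₁ f) (tendsto_bracketAtBot w₂ f)
    (tendsto_bracketAtBot w₁ g) (tendsto_bracketAtBot w₂ g)
  rw [inner_tauL2_sub_inner_tauL2, tendsto_nhds_unique (tendsto_bracketAtTop f g) hTop,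
    tendsto_nhds_unique (tendsto_bracketAtBot f g) hBot]
  rfl

theorem boundaryValues_fst : boundaryValues w₁ w₂ w₁ = (![0, -1], ![0, -1]) := by
  have h₁ : bracket w₁ w₁ = fun _ => 0 := by
    ext x
    rw [hw.bracket_fst, mul_comm, sub_self]
  have h₂ : bracket w₂ w₁ = fun _ => -1 := by
    ext x
    rw [← neg_neg (bracket w₂ w₁ x), ← conj_bracket, hw.bracket_eq_one, map_one]
  refine hasBoundaryValues_iff.1 ?_
  constructor <;> simp [h₁, h₂]

theorem boundaryValues_snd : boundaryValues w₁ w₂ w₂ = (![1, 0], ![1, 0]) := by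
  have h₁ : bracket w₁ w₂ = fun _ => 1 := funext hw.bracket_eq_one
  have h₂ : bracket w₂ w₂ = fun _ => 0 := by
    ext x
    rw [hw.bracket_snd, mul_comm, sub_self]
  refine hasBoundaryValues_iff.1 ?_
  constructor <;> simp [h₁, h₂]

theorem exists_tauL2_eq (g : L2) :
    ∃ y : maxDomain q, tauL2 q y = g ∧ boundaryValues w₁ w₂ y =
      (0, ![-inner ℂ (toL2 q w₁) g, -inner ℂ (toL2 q w₂) g]) := by
  have hg := Lp.memLp g
  have hlim (w : maxDomain q) :
      Tendsto (-innerIic w g) atTop (𝓝 (-inner ℂ (toL2 q w) g)) := by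
    have h := (tendsto_innerIic_atTop w.2.2.1 hg).neg
    rwa [Lp.toLp_coeFn] at h
  have hzero (w : ℝ → ℂ) : Tendsto (-innerIic w g) atBot (𝓝 0) :=
    neg_zero (G := ℂ) ▸ (tendsto_innerIic_atBot w g).neg
  refine ⟨⟨particularSolution w₁ w₂ g, hw.particularSolution_mem_maxDomain hg⟩, ?_,
    hasBoundaryValues_iff.1 ?_⟩
  · exact (MemLp.toLp_congr (hw.particularSolution_mem_maxDomain hg).2.2 hg
      (hw.tau_particularSolution hg)).trans (Lp.toLp_coeFn g hg)
  · constructor <;>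
      simp only [hw.bracket_fst_particularSolution hg, hw.bracket_snd_particularSolution hg]
    exacts [hzero w₁, hzero w₂, hlim w₁, hlim w₂]

theorem linearIndependent_toL2 : LinearIndependent ℂ ![toL2 q w₁, toL2 q w₂] := by
  refine LinearIndependent.pair_iff.2 fun s t hst => ?_
  rw [← map_smul, ← map_smul, ← map_add, map_eq_zero_iff _ (toL2_injective q)] at hst
  have h := congrArg (boundaryValues w₁ w₂) hst
  rw [map_add, map_smul, map_smul, hw.boundaryValues_fst, hw.boundaryValues_snd, map_zero] at h
  exact ⟨by simpa using congrFun (congrArg Prod.fst h) 1,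
    by simpa using congrFun (congrArg Prod.fst h) 0⟩

theorem boundaryValues_surjective : Function.Surjective (boundaryValues w₁ w₂) := by
  intro p
  obtain ⟨g, hg⟩ := exists_forall_inner_eq_of_linearIndependent hw.linearIndependent_toL2
    (p.1 - p.2)
  have hg₁ : inner ℂ (toL2 q w₁) g = p.1 0 - p.2 0 := hg 0
  have hg₂ : inner ℂ (toL2 q w₂) g = p.1 1 - p.2 1 := hg 1
  obtain ⟨y, -, hy⟩ := hw.exists_tauL2_eq g
  refine ⟨y - p.1 1 • w₁ + p.1 0 • w₂, ?_⟩
  rw [map_add, map_sub, map_smul, map_smul, hy, hg₁, hg₂, hw.boundaryValues_fst,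
    hw.boundaryValues_snd]
  ext i <;> fin_cases i <;> simp

end IsRealFundamentalSystem

/-! ### Adjoints of the extensions -/

theorem mem_graph_restrictedOperator {q : ℝ → ℝ} {D : Submodule ℂ (maxDomain q)} {x : L2 × L2} :
    x ∈ (restrictedOperator q D).graph ↔ ∃ f ∈ D, toL2 q f = x.1 ∧ tauL2 q f = x.2 := by
  rw [LinearPMap.mem_graph_iff]
  constructor
  · rintro ⟨⟨_, f, hf, rfl⟩, hfst, hsnd⟩
    exact ⟨f, hf, hfst, (restrictedOperator_apply q D f hf).symm.trans hsnd⟩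
  · rintro ⟨f, hf, hfst, hsnd⟩
    exact ⟨⟨toL2 q f, Submodule.mem_map_of_mem hf⟩, hfst,
      (restrictedOperator_apply q D f hf).trans hsnd⟩

theorem mem_graph_extensionOf {q : ℝ → ℝ} {w₁ w₂ : maxDomain q} {S : Submodule ℂ BoundarySpace}
    {x : L2 × L2} :
    x ∈ (extensionOf q w₁ w₂ S).graph ↔
      ∃ f, boundaryValues w₁ w₂ f ∈ S ∧ toL2 q f = x.1 ∧ tauL2 q f = x.2 := by
  rw [extensionOf, boundaryDomain_eq_comap, mem_graph_restrictedOperator]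
  simp only [Submodule.mem_comap]

theorem domain_extensionOf {q : ℝ → ℝ} (w₁ w₂ : maxDomain q) (S : Submodule ℂ BoundarySpace) :
    (extensionOf q w₁ w₂ S).domain = (S.comap (boundaryValues w₁ w₂)).map (toL2 q) := by
  rw [← boundaryDomain_eq_comap]
  rfl

namespace IsRealFundamentalSystem

variable {q : ℝ → ℝ} {w₁ w₂ : maxDomain q} (hw : IsRealFundamentalSystem w₁ w₂)
include hw

-- A solution `u` of `τ_q u = k` differs from `h` by a vector orthogonal to all `g` orthogonal to
-- `w₁` and `w₂`: these are the `g = τ_q y` with `y` having vanishing boundary values.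
theorem exists_toL2_eq_and_tauL2_eq {h k : L2}
    (hk : ∀ f, boundaryValues w₁ w₂ f = 0 → inner ℂ (tauL2 q f) h = inner ℂ (toL2 q f) k) :
    ∃ v, toL2 q v = h ∧ tauL2 q v = k := by
  obtain ⟨u, hu, -⟩ := hw.exists_tauL2_eq k
  let W : Submodule ℂ L2 := Submodule.span ℂ {toL2 q w₁, toL2 q w₂}
  have : FiniteDimensional ℂ W := FiniteDimensional.span_of_finite ℂ (Set.toFinite _)
  have horth : h - toL2 q u ∈ Wᗮᗮ := by
    intro g hg
    obtain ⟨y, hy, hyΓ⟩ := hw.exists_tauL2_eq g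
    have hg₁ : inner ℂ (toL2 q w₁) g = 0 := hg _ (Submodule.subset_span (by simp))
    have hg₂ : inner ℂ (toL2 q w₂) g = 0 := hg _ (Submodule.subset_span (by simp))
    have hyΓ' : boundaryValues w₁ w₂ y = 0 := by
      rw [hyΓ, hg₁, hg₂]
      ext i <;> fin_cases i <;> simp
    have hGreen := hw.inner_tauL2_sub_inner_tauL2_eq_boundaryForm y u
    rw [hyΓ', map_zero, LinearMap.zero_apply, hu, sub_eq_zero, ← hk y hyΓ', hy] at hGreen
    rw [inner_sub_right, hGreen, sub_self]
  rw [Submodule.orthogonal_orthogonal, Submodule.mem_span_pair] at horth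
  obtain ⟨c, d, hcd⟩ := horth
  refine ⟨u + (c • w₁ + d • w₂), ?_, ?_⟩
  · rw [map_add, map_add, map_smul, map_smul, hcd, add_sub_cancel]
  · rw [map_add, map_add, map_smul, map_smul, tauL2_eq_zero hw.solution_fst,
      tauL2_eq_zero hw.solution_snd, smul_zero, smul_zero, add_zero, add_zero, hu]

theorem dense_domain_extensionOf (S : Submodule ℂ BoundarySpace) :
    Dense ((extensionOf q w₁ w₂ S).domain : Set L2) := by
  rw [Submodule.dense_iff_topologicalClosure_eq_top, Submodule.topologicalClosure_eq_top_iff,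
    Submodule.eq_bot_iff, domain_extensionOf]
  intro k hk
  obtain ⟨v, hv, rfl⟩ := hw.exists_toL2_eq_and_tauL2_eq (h := 0) (k := k) fun f hf => by
    rw [inner_zero_right, hk _ (Submodule.mem_map_of_mem _)]
    rw [Submodule.mem_comap, hf]
    exact S.zero_mem
  rw [(map_eq_zero_iff _ (toL2_injective q)).1 hv, map_zero]

theorem adjoint_extensionOf (S : Submodule ℂ BoundarySpace) :
    (extensionOf q w₁ w₂ S).adjoint = extensionOf q w₁ w₂ (S.orthogonalBilin boundaryForm) := by
  refine LinearPMap.eq_of_eq_graph ?_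
  rw [LinearPMap.adjoint_graph_eq_graph_adjoint (hw.dense_domain_extensionOf S)]
  ext ⟨h, k⟩
  rw [Submodule.mem_adjoint_iff, mem_graph_extensionOf]
  constructor
  · intro hhk
    have hgraph (f : maxDomain q) (hf : boundaryValues w₁ w₂ f ∈ S) :
        inner ℂ (tauL2 q f) h - inner ℂ (toL2 q f) k = 0 :=
      hhk _ _ (mem_graph_extensionOf.2 ⟨f, hf, rfl, rfl⟩)
    obtain ⟨v, rfl, rfl⟩ := hw.exists_toL2_eq_and_tauL2_eq fun f hf =>
      sub_eq_zero.1 (hgraph f (hf ▸ S.zero_mem))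
    refine ⟨v, fun s hs => ?_, rfl, rfl⟩
    obtain ⟨f, rfl⟩ := hw.boundaryValues_surjective s
    rw [← hw.inner_tauL2_sub_inner_tauL2_eq_boundaryForm, hgraph f hs]
  · rintro ⟨v, hv, rfl, rfl⟩ _ _ hab
    obtain ⟨f, hf, rfl, rfl⟩ := mem_graph_extensionOf.1 hab
    rw [hw.inner_tauL2_sub_inner_tauL2_eq_boundaryForm, hv _ hf]

theorem extensionOf_injective :
    Function.Injective fun S : Submodule ℂ BoundarySpace => extensionOf q w₁ w₂ S := by
  intro S T hST
  have hdomain := congrArg LinearPMap.domain hST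
  simp only [domain_extensionOf] at hdomain
  exact Submodule.comap_injective_of_surjective hw.boundaryValues_surjective
    (Submodule.map_injective_of_injective (toL2_injective q) hdomain)

end IsRealFundamentalSystem

/-! ### Parity -/

theorem IsRegular.comp_neg {f : ℝ → ℂ} (hf : IsRegular f) : IsRegular fun x => f (-x) where
  differentiable := hf.differentiable.comp differentiable_neg
  acLoc := hf.acLoc.comp_neg
  acLoc_deriv := by
    rw [funext (deriv_comp_neg f)]
    exact hf.acLoc_deriv.comp_neg.neg

theorem tau_comp_neg {q : ℝ → ℝ} (heven : ∀ x, q (-x) = q x) (f : ℝ → ℂ) :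
    tau q (fun x => f (-x)) = fun x => tau q f (-x) := by
  ext x
  rw [tau, tau, funext (deriv_comp_neg f), deriv.fun_neg, deriv_comp_neg, neg_neg, heven]

theorem bracket_comp_neg (f g : ℝ → ℂ) (x : ℝ) :
    bracket (fun x => f (-x)) (fun x => g (-x)) x = -bracket f g (-x) := by
  simp only [bracket, deriv_comp_neg, map_neg]
  ring

theorem bracket_neg_left (f g : ℝ → ℂ) (x : ℝ) : bracket (fun x => -f x) g x = -bracket f g x := by
  simp only [bracket, deriv.fun_neg, map_neg]
  ring

/-- The reflection `f ↦ f (-·)` of the maximal domain of an even potential. -/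
def reflect {q : ℝ → ℝ} (heven : ∀ x, q (-x) = q x) (f : maxDomain q) : maxDomain q :=
  ⟨fun x => (f : ℝ → ℂ) (-x), f.2.1.comp_neg,
    f.2.2.1.comp_measurePreserving (Measure.measurePreserving_neg volume), by
    rw [tau_comp_neg heven]
    exact f.2.2.2.comp_measurePreserving (Measure.measurePreserving_neg volume)⟩

theorem toL2_reflect {q : ℝ → ℝ} (heven : ∀ x, q (-x) = q x) (f : maxDomain q) :
    toL2 q (reflect heven f) = parity (toL2 q f) := rfl

theorem tauL2_reflect {q : ℝ → ℝ} (heven : ∀ x, q (-x) = q x) (f : maxDomain q) :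
    tauL2 q (reflect heven f) = parity (tauL2 q f) :=
  MemLp.toLp_congr (reflect heven f).2.2.2
    (f.2.2.2.comp_measurePreserving (Measure.measurePreserving_neg volume))
    (.of_eq (tau_comp_neg heven f))

theorem parity_parity (f : L2) : parity (parity f) = f := by
  have hf := Lp.memLp f
  have hneg := Measure.measurePreserving_neg (volume : Measure ℝ)
  have htwice : parity (parity (hf.toLp f)) = ((hf.comp_measurePreserving
      hneg).comp_measurePreserving hneg).toLp _ := rfl
  rw [Lp.toLp_coeFn] at htwice
  rw [htwice]
  conv_rhs => rw [← Lp.toLp_coeFn f hf]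
  exact MemLp.toLp_congr _ hf (.of_eq (funext fun x => congrArg f (neg_neg x)))

/-- The action of the reflection of the line on boundary values, for odd `w₁` and even `w₂`. -/
def boundaryFlip : BoundarySpace →ₗ[ℂ] BoundarySpace where
  toFun p := (![p.2 0, -p.2 1], ![p.1 0, -p.1 1])
  map_add' p r := by ext i <;> fin_cases i <;> simp [add_comm]
  map_smul' c p := by ext i <;> fin_cases i <;> simp

theorem boundaryFlip_boundaryFlip (p : BoundarySpace) : boundaryFlip (boundaryFlip p) = p := by
  ext i <;> fin_cases i <;> simp [boundaryFlip]

theorem boundaryValues_reflect {q : ℝ → ℝ} (heven : ∀ x, q (-x) = q x) {w₁ w₂ : maxDomain q}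
    (hw : IsNormalizedPair q w₁ w₂) (f : maxDomain q) :
    boundaryValues w₁ w₂ (reflect heven f) = boundaryFlip (boundaryValues w₁ w₂ f) := by
  have hodd (x : ℝ) : bracket w₁ (reflect heven f) x = bracket w₁ f (-x) := by
    rw [← neg_neg (bracket w₁ f (-x)), ← bracket_comp_neg, funext hw.odd_fst, bracket_neg_left,
      neg_neg]
    rfl
  have heven' (x : ℝ) : bracket w₂ (reflect heven f) x = -bracket w₂ f (-x) := by
    rw [← bracket_comp_neg, funext hw.even_snd]
    rfl
  refine hasBoundaryValues_iff.1 ?_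
  constructor <;> simp only [funext hodd, funext heven']
  · exact (tendsto_bracketAtTop w₁ f).comp tendsto_neg_atBot_atTop
  · exact ((tendsto_bracketAtTop w₂ f).comp tendsto_neg_atBot_atTop).neg
  · exact (tendsto_bracketAtBot w₁ f).comp tendsto_neg_atTop_atBot
  · exact ((tendsto_bracketAtBot w₂ f).comp tendsto_neg_atTop_atBot).neg

theorem isPSelfAdjoint_iff_graph_eq {H : L2 →ₗ.[ℂ] L2} (hH : Dense (H.domain : Set L2)) :
    IsPSelfAdjoint H ↔ H.graph =
      H.adjoint.graph.comap (parity.toLinearMap.prodMap parity.toLinearMap) := by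
  constructor
  · rintro ⟨-, -, hdom, happly⟩
    ext ⟨x, y⟩
    rw [Submodule.mem_comap, LinearMap.prodMap_apply]
    change _ ↔ (parity x, parity y) ∈ _
    constructor
    · intro hxy
      obtain ⟨f, rfl, rfl⟩ := (H.mem_graph_iff).1 hxy
      have hPf := (hdom f).1 f.2
      rw [happly f ⟨parity f, hPf⟩ rfl, parity_parity]
      exact H.adjoint.mem_graph ⟨parity f, hPf⟩
    · intro hxy
      obtain ⟨g, hgx, hgy⟩ := H.adjoint.mem_graph_iff.1 hxy
      simp only at hgx hgy
      have hx : x ∈ H.domain := (hdom x).2 (hgx ▸ g.2)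
      rw [← parity_parity y, ← hgy, ← happly ⟨x, hx⟩ g hgx]
      exact H.mem_graph ⟨x, hx⟩
  · intro hgraph
    have hmem (x y : L2) : (x, y) ∈ H.graph ↔ (parity x, parity y) ∈ H.adjoint.graph := by
      rw [hgraph]
      rfl
    refine ⟨hH, ?_, fun f => ?_, fun f g hgf => ?_⟩
    · rw [LinearPMap.IsClosed, hgraph]
      exact (LinearPMap.adjoint_isClosed hH).preimage
        (parity.continuous.prodMap parity.continuous)
    · rw [LinearPMap.mem_domain_iff, LinearPMap.mem_domain_iff]
      exact ⟨fun ⟨y, hy⟩ => ⟨_, (hmem _ _).1 hy⟩,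
        fun ⟨y, hy⟩ => ⟨parity y, (hmem _ _).2 (by rwa [parity_parity])⟩⟩
    · rw [H.adjoint.mem_graph_snd_inj (H.adjoint.mem_graph g) ((hmem _ _).1 (H.mem_graph f)) hgf,
        parity_parity]

theorem comap_parity_graph_extensionOf {q : ℝ → ℝ} (heven : ∀ x, q (-x) = q x)
    {w₁ w₂ : maxDomain q} (hw : IsNormalizedPair q w₁ w₂) (S : Submodule ℂ BoundarySpace) :
    (extensionOf q w₁ w₂ S).graph.comap (parity.toLinearMap.prodMap parity.toLinearMap) =
      (extensionOf q w₁ w₂ (S.comap boundaryFlip)).graph := by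
  ext ⟨x, y⟩
  rw [Submodule.mem_comap, mem_graph_extensionOf, mem_graph_extensionOf]
  constructor
  · rintro ⟨f, hf, hx, hy⟩
    refine ⟨reflect heven f, ?_, ?_, ?_⟩
    · rwa [Submodule.mem_comap, boundaryValues_reflect heven hw, boundaryFlip_boundaryFlip]
    · rw [toL2_reflect, hx]
      exact parity_parity x
    · rw [tauL2_reflect, hy]
      exact parity_parity y
  · rintro ⟨f, hf, rfl, rfl⟩
    refine ⟨reflect heven f, ?_, toL2_reflect heven f, tauL2_reflect heven f⟩
    rwa [boundaryValues_reflect heven hw]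

/-- The boundary condition of `P H* P`, where `H` is the operator with boundary condition `S`. -/
def parityDual (S : Submodule ℂ BoundarySpace) : Submodule ℂ BoundarySpace :=
  (S.orthogonalBilin boundaryForm).comap boundaryFlip

theorem isPSelfAdjoint_extensionOf_iff {q : ℝ → ℝ} (heven : ∀ x, q (-x) = q x)
    {w₁ w₂ : maxDomain q} (hw : IsNormalizedPair q w₁ w₂) (S : Submodule ℂ BoundarySpace) :
    IsPSelfAdjoint (extensionOf q w₁ w₂ S) ↔ S = parityDual S := by
  have hw' := hw.isRealFundamentalSystem
  rw [isPSelfAdjoint_iff_graph_eq (hw'.dense_domain_extensionOf S), hw'.adjoint_extensionOf,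
    comap_parity_graph_extensionOf heven hw]
  exact ⟨fun h => hw'.extensionOf_injective (LinearPMap.eq_of_eq_graph h),
    fun h => congrArg (fun T => (extensionOf q w₁ w₂ T).graph) h⟩

/-! ### Boundary conditions that coincide with their parity dual -/

theorem mem_parityDual_iff {S : Submodule ℂ BoundarySpace} {r : BoundarySpace} :
    r ∈ parityDual S ↔ ∀ s ∈ S,
      conj (s.1 0) * r.2 1 + conj (s.1 1) * r.2 0 =
        conj (s.2 0) * r.1 1 + conj (s.2 1) * r.1 0 := by
  refine forall₂_congr fun s _ => ?_
  rw [boundaryForm_apply, ← sub_eq_zero (a := conj (s.1 0) * r.2 1 + _)]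
  simp only [boundaryFlip, LinearMap.coe_mk, AddHom.coe_mk, Matrix.cons_val_zero,
    Matrix.cons_val_one]
  ring_nf

theorem mem_mixedConditionLeft_iff {a b c d : ℂ} {p : BoundarySpace} :
    p ∈ mixedConditionLeft !![a, b; c, d] ↔
      p.1 0 = a * p.2 0 + b * p.2 1 ∧ p.1 1 = c * p.2 0 + d * p.2 1 := by
  change p.1 = _ ↔ _
  simp only [funext_iff, Fin.forall_fin_two, Matrix.mulVec, dotProduct, Fin.sum_univ_two,
    Matrix.of_apply, Matrix.cons_val_zero, Matrix.cons_val_one]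

theorem mixedConditionLeft_injective : Function.Injective mixedConditionLeft := by
  intro M N hMN
  refine Matrix.mulVec_injective (funext fun x => ?_)
  have hx : (M.mulVec x, x) ∈ mixedConditionLeft N := hMN ▸ (rfl : M.mulVec x = M.mulVec x)
  exact hx

theorem parityDual_mixedConditionLeft (a b c d : ℂ) :
    parityDual (mixedConditionLeft !![a, b; c, d]) =
      mixedConditionLeft !![conj d, conj b; conj c, conj a] := by
  ext r
  simp only [mem_parityDual_iff, mem_mixedConditionLeft_iff]
  constructor
  · intro h
    have h₀ := h (![a, c], ![1, 0]) (by simp)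
    have h₁ := h (![b, d], ![0, 1]) (by simp)
    simp only [Matrix.cons_val_zero, Matrix.cons_val_one, map_one, one_mul, map_zero, zero_mul,
      add_zero, zero_add] at h₀ h₁
    exact ⟨by rw [← h₁, add_comm], by rw [← h₀, add_comm]⟩
  · rintro ⟨hr₀, hr₁⟩ s ⟨hs₀, hs₁⟩
    rw [hr₀, hr₁, hs₀, hs₁]
    simp only [map_add, map_mul]
    ring

theorem mixedConditionLeft_eq_parityDual_iff (a b c d : ℂ) :
    mixedConditionLeft !![a, b; c, d] = parityDual (mixedConditionLeft !![a, b; c, d]) ↔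
      d = conj a ∧ b.im = 0 ∧ c.im = 0 := by
  rw [parityDual_mixedConditionLeft, mixedConditionLeft_injective.eq_iff, ← Complex.conj_eq_iff_im,
    ← Complex.conj_eq_iff_im]
  simp only [← Matrix.ext_iff, Fin.forall_fin_two, Matrix.of_apply, Matrix.cons_val_zero,
    Matrix.cons_val_one]
  constructor
  · rintro ⟨⟨-, hb⟩, hc, hd⟩
    exact ⟨hd, hb.symm, hc.symm⟩
  · rintro ⟨rfl, hb, hc⟩
    exact ⟨⟨(Complex.conj_conj a).symm, hb.symm⟩, hc.symm, rfl⟩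

theorem parityDual_comap_prodComm (S : Submodule ℂ BoundarySpace) :
    parityDual (S.comap (LinearEquiv.prodComm ℂ (Fin 2 → ℂ) (Fin 2 → ℂ)).toLinearMap) =
      (parityDual S).comap (LinearEquiv.prodComm ℂ (Fin 2 → ℂ) (Fin 2 → ℂ)).toLinearMap := by
  ext r
  simp only [Submodule.mem_comap, mem_parityDual_iff]
  exact ⟨fun h s hs => (h s.swap hs).symm, fun h s hs => (h s.swap hs).symm⟩

theorem mixedConditionRight_eq_parityDual_iff (M : Matrix (Fin 2) (Fin 2) ℂ) :
    mixedConditionRight M = parityDual (mixedConditionRight M) ↔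
      mixedConditionLeft M = parityDual (mixedConditionLeft M) := by
  have hcomap : mixedConditionRight M = (mixedConditionLeft M).comap
    (LinearEquiv.prodComm ℂ (Fin 2 → ℂ) (Fin 2 → ℂ)).toLinearMap := rfl
  rw [hcomap, parityDual_comap_prodComm]
  exact (Submodule.comap_injective_of_surjective (LinearEquiv.surjective _)).eq_iff

theorem mem_span_singleton_fin_two_iff {K : Type*} [Field K] {v x : Fin 2 → K} (hv : v ≠ 0) :
    x ∈ Submodule.span K {v} ↔ x 0 * v 1 = v 0 * x 1 := by
  rw [Submodule.mem_span_singleton]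
  constructor
  · rintro ⟨c, rfl⟩
    simp only [Pi.smul_apply, smul_eq_mul]
    ring
  · intro h
    obtain ⟨i, hi⟩ := Function.ne_iff.1 hv
    rw [Pi.zero_apply] at hi
    refine ⟨x i / v i, funext (Fin.forall_fin_two.2 ⟨?_, ?_⟩)⟩ <;> fin_cases i <;>
      simp only [Fin.zero_eta, Fin.mk_one, Pi.smul_apply, smul_eq_mul] at hi ⊢ <;> field_simp
    · linear_combination -h
    · linear_combination h

theorem span_singleton_fin_two_eq_iff {K : Type*} [Field K] {v w : Fin 2 → K} (hv : v ≠ 0)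
    (hw : w ≠ 0) : Submodule.span K {v} = Submodule.span K {w} ↔ v 0 * w 1 = w 0 * v 1 := by
  rw [le_antisymm_iff, Submodule.span_singleton_le_iff_mem, Submodule.span_singleton_le_iff_mem,
    mem_span_singleton_fin_two_iff hv, mem_span_singleton_fin_two_iff hw, eq_comm (a := w 0 * v 1),
    and_self]

theorem prod_eq_prod_iff {R M N : Type*} [Semiring R] [AddCommMonoid M] [Module R M]
    [AddCommMonoid N] [Module R N] {p p' : Submodule R M} {r r' : Submodule R N} :
    p.prod r = p'.prod r' ↔ p = p' ∧ r = r' := by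
  constructor
  · intro h
    exact ⟨by rw [← Submodule.prod_map_fst p r, h, Submodule.prod_map_fst],
      by rw [← Submodule.prod_map_snd p r, h, Submodule.prod_map_snd]⟩
  · rintro ⟨rfl, rfl⟩
    rfl

theorem conj_reflection_ne_zero {v : Fin 2 → ℂ} (hv : v ≠ 0) : ![conj (v 0), -conj (v 1)] ≠ 0 := by
  simpa [funext_iff, Fin.forall_fin_two] using hv

theorem parityDual_prod_span_singleton {v w : Fin 2 → ℂ} (hv : v ≠ 0) (hw : w ≠ 0) :
    parityDual ((Submodule.span ℂ {v}).prod (Submodule.span ℂ {w})) =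
      (Submodule.span ℂ {![conj (w 0), -conj (w 1)]}).prod
        (Submodule.span ℂ {![conj (v 0), -conj (v 1)]}) := by
  ext r
  simp only [mem_parityDual_iff, Submodule.mem_prod,
    mem_span_singleton_fin_two_iff (conj_reflection_ne_zero hv),
    mem_span_singleton_fin_two_iff (conj_reflection_ne_zero hw), Matrix.cons_val_zero,
    Matrix.cons_val_one]
  constructor
  · intro h
    have hvr := h (v, 0) ⟨Submodule.mem_span_singleton_self v, zero_mem _⟩
    have hwr := h (0, w) ⟨zero_mem _, Submodule.mem_span_singleton_self w⟩
    simp only [Pi.zero_apply, map_zero, zero_mul, add_zero] at hvr hwr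
    exact ⟨by linear_combination hwr, by linear_combination -hvr⟩
  · rintro ⟨hwr, hvr⟩ s ⟨hs₁, hs₂⟩
    obtain ⟨c, hc⟩ := Submodule.mem_span_singleton.1 hs₁
    obtain ⟨d, hd⟩ := Submodule.mem_span_singleton.1 hs₂
    simp only [← hc, ← hd, Pi.smul_apply, smul_eq_mul, map_mul]
    linear_combination conj d * hwr - conj c * hvr

theorem prod_span_singleton_eq_parityDual_iff {v w : Fin 2 → ℂ} (hv : v ≠ 0) (hw : w ≠ 0) :
    (Submodule.span ℂ {v}).prod (Submodule.span ℂ {w}) =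
        parityDual ((Submodule.span ℂ {v}).prod (Submodule.span ℂ {w})) ↔
      v 0 * conj (w 1) + v 1 * conj (w 0) = 0 := by
  rw [parityDual_prod_span_singleton hv hw, prod_eq_prod_iff,
    span_singleton_fin_two_eq_iff hv (conj_reflection_ne_zero hw),
    span_singleton_fin_two_eq_iff hw (conj_reflection_ne_zero hv)]
  simp only [Matrix.cons_val_zero, Matrix.cons_val_one]
  constructor
  · rintro ⟨h, -⟩
    linear_combination -h
  · intro h
    have hconj := congrArg conj h
    simp only [map_add, map_mul, Complex.conj_conj, map_zero] at hconj
    exact ⟨by linear_combination -h, by linear_combination -hconj⟩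

theorem sin_mul_cos_vector_ne_zero {ξ : ℂ} (hξ : ξ ≠ 0) (α : ℝ) :
    ![(Real.sin α : ℂ), ξ * (Real.cos α : ℂ)] ≠ 0 := by
  intro h
  have hsin : Real.sin α = 0 := Complex.ofReal_eq_zero.1 (congrFun h 0)
  have hcos : Real.cos α = 0 :=
    Complex.ofReal_eq_zero.1 ((mul_eq_zero.1 (congrFun h 1)).resolve_left hξ)
  have hone := Real.sin_sq_add_cos_sq α
  rw [hsin, hcos] at hone
  norm_num at hone

theorem separatedCondition_eq_prod {ξ η : ℂ} (hξ : ξ ≠ 0) (hη : η ≠ 0) (α β : ℝ) :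
    separatedCondition ξ η α β =
      (Submodule.span ℂ {![(Real.sin α : ℂ), ξ * (Real.cos α : ℂ)]}).prod
        (Submodule.span ℂ {![(Real.sin β : ℂ), η * (Real.cos β : ℂ)]}) := by
  ext p
  rw [Submodule.mem_prod, mem_span_singleton_fin_two_iff (sin_mul_cos_vector_ne_zero hξ α),
    mem_span_singleton_fin_two_iff (sin_mul_cos_vector_ne_zero hη β)]
  refine and_congr ?_ ?_ <;> rw [sub_eq_zero, mul_assoc, mul_comm (_ : ℂ) (Real.sin _ : ℂ)] <;> rfl

theorem separatedCondition_eq_parityDual_iff {ξ η : ℂ} (hξ : ξ ≠ 0) (hη : ‖η‖ = 1) (α β : ℝ) :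
    separatedCondition ξ η α β = parityDual (separatedCondition ξ η α β) ↔
      ((Real.sin α * Real.cos β : ℝ) : ℂ) + ξ * η * ((Real.cos α * Real.sin β : ℝ) : ℂ) = 0 := by
  have hη₀ : η ≠ 0 := norm_ne_zero_iff.1 (hη ▸ one_ne_zero)
  have hηη : η * conj η = 1 := by
    rw [Complex.mul_conj', hη, Complex.ofReal_one, one_pow]
  rw [separatedCondition_eq_prod hξ hη₀, prod_span_singleton_eq_parityDual_iff
    (sin_mul_cos_vector_ne_zero hξ α) (sin_mul_cos_vector_ne_zero hη₀ β), ← mul_right_inj' hη₀,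
    mul_zero]
  simp only [Matrix.cons_val_zero, Matrix.cons_val_one, map_mul, Complex.conj_ofReal,
    Complex.ofReal_mul]
  rw [mul_add, ← mul_assoc, ← mul_assoc]
  constructor <;> intro h
  · linear_combination h - (Real.sin α : ℂ) * (Real.cos β : ℂ) * hηη
  · linear_combination h + (Real.sin α : ℂ) * (Real.cos β : ℂ) * hηη

theorem modEq_zero_pi_iff (x : ℝ) : x ≡ 0 [PMOD Real.pi] ↔ Real.sin x = 0 := by
  rw [AddCommGroup.modEq_zero_iff_eq_zsmul, Real.sin_eq_zero_iff]
  exact exists_congr fun n => by rw [zsmul_eq_mul, eq_comm]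

theorem abs_modEq_zero_pi_iff (x : ℝ) : |x| ≡ 0 [PMOD Real.pi] ↔ Real.sin x = 0 := by
  rw [modEq_zero_pi_iff]
  rcases abs_choice x with h | h <;> rw [h]
  rw [Real.sin_neg, neg_eq_zero]

theorem mem_quarterTurns_iff {α : ℝ} (hα : α ∈ Set.Ico (0 : ℝ) (2 * Real.pi)) :
    α ∈ ({0, Real.pi / 2, Real.pi, 3 * Real.pi / 2} : Set ℝ) ↔
      Real.sin α * Real.cos α = 0 := by
  have hdouble : Real.sin α * Real.cos α = 0 ↔ ∃ n : ℤ, (n : ℝ) * Real.pi = 2 * α := by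
    rw [← Real.sin_eq_zero_iff, Real.sin_two_mul, mul_assoc, mul_eq_zero_iff_left two_ne_zero]
  have hpi := Real.pi_pos
  rw [hdouble]
  constructor
  · rintro (rfl | rfl | rfl | rfl)
    exacts [⟨0, by simp⟩, ⟨1, by ring⟩, ⟨2, by simp⟩, ⟨3, by ring⟩]
  · rintro ⟨n, hn⟩
    obtain ⟨hα₀, hα₁⟩ := hα
    have hn₀ : 0 ≤ n := by
      by_contra! h
      have : (n : ℝ) < 0 := by exact_mod_cast h
      nlinarith
    have hn₁ : n < 4 := by
      by_contra! h
      have : (4 : ℝ) ≤ n := by exact_mod_cast h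
      nlinarith
    have hα_eq : α = n * Real.pi / 2 := by linarith
    interval_cases n <;> simp [hα_eq]

theorem add_mul_eq_zero_iff_of_mul_eq_zero {ζ : ℂ} (hζ : ζ ≠ 0) {x y : ℝ} (hxy : x * y = 0) :
    (x : ℂ) + ζ * (y : ℂ) = 0 ↔ x + y = 0 := by
  rcases mul_eq_zero.1 hxy with rfl | rfl <;> simp [hζ]

theorem add_mul_eq_zero_iff_of_norm_eq_one {ζ : ℂ} (hζ : ‖ζ‖ = 1) {x y : ℝ} (hy : y ≠ 0) :
    (x : ℂ) + ζ * (y : ℂ) = 0 ↔ (x + y = 0 ∧ ζ = 1) ∨ (x - y = 0 ∧ ζ = -1) := by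
  have hy' : (y : ℂ) ≠ 0 := Complex.ofReal_ne_zero.2 hy
  constructor
  · intro h
    have habs : |x| = |y| := by
      simpa [hζ] using congrArg norm (eq_neg_of_add_eq_zero_left h)
    rcases abs_eq_abs.1 habs with rfl | rfl
    · exact Or.inr ⟨sub_self _, mul_right_cancel₀ hy' (by linear_combination h)⟩
    · rw [Complex.ofReal_neg] at h
      exact Or.inl ⟨neg_add_cancel y, mul_right_cancel₀ hy' (by linear_combination h)⟩
  · rintro (⟨h, rfl⟩ | ⟨h, rfl⟩)
    · rw [one_mul, ← Complex.ofReal_add, h, Complex.ofReal_zero]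
    · rw [neg_one_mul, ← sub_eq_add_neg, ← Complex.ofReal_sub, h, Complex.ofReal_zero]

end PTSL

end

theorem mainTheorem6 (q : ℝ → ℝ) (hq : MeasureTheory.LocallyIntegrable q MeasureTheory.volume)
    (heven : ∀ x, q (-x) = q x)
    (htop : PTSL.LimitCircleAtTop q) (hbot : PTSL.LimitCircleAtBot q)
    (w₁ w₂ : ℝ → ℂ) (hw : PTSL.IsNormalizedPair q w₁ w₂) :
    (∀ ξ η : ℂ, ‖ξ‖ = 1 → ‖η‖ = 1 →
      ∀ α ∈ Set.Ico (0 : ℝ) (2 * Real.pi), ∀ β ∈ Set.Ico (0 : ℝ) (2 * Real.pi),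
        ((α ∈ ({0, Real.pi / 2, Real.pi, 3 * Real.pi / 2} : Set ℝ) ∨
            β ∈ ({0, Real.pi / 2, Real.pi, 3 * Real.pi / 2} : Set ℝ)) →
          (PTSL.IsPSelfAdjoint
              (PTSL.extensionOf q w₁ w₂ (PTSL.separatedCondition ξ η α β)) ↔
            α + β ≡ 0 [PMOD Real.pi])) ∧
        ((α ∉ ({0, Real.pi / 2, Real.pi, 3 * Real.pi / 2} : Set ℝ) ∧
            β ∉ ({0, Real.pi / 2, Real.pi, 3 * Real.pi / 2} : Set ℝ)) →
          (PTSL.IsPSelfAdjoint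
              (PTSL.extensionOf q w₁ w₂ (PTSL.separatedCondition ξ η α β)) ↔
            (α + β ≡ 0 [PMOD Real.pi] ∧ ξ * η = 1) ∨
            (|α - β| ≡ 0 [PMOD Real.pi] ∧ ξ * η = -1)))) ∧
    (∀ a b c d : ℂ,
      (PTSL.IsPSelfAdjoint
          (PTSL.extensionOf q w₁ w₂ (PTSL.mixedConditionLeft !![a, b; c, d])) ↔
        d = (starRingEnd ℂ) a ∧ b.im = 0 ∧ c.im = 0) ∧
      (PTSL.IsPSelfAdjoint
          (PTSL.extensionOf q w₁ w₂ (PTSL.mixedConditionRight !![a, b; c, d])) ↔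
        d = (starRingEnd ℂ) a ∧ b.im = 0 ∧ c.im = 0)) := by
  have h₁ := hw.solution_fst.mem_maxDomain htop hbot
  have h₂ := hw.solution_snd.mem_maxDomain htop hbot
  have key := PTSL.isPSelfAdjoint_extensionOf_iff heven (w₁ := ⟨w₁, h₁⟩) (w₂ := ⟨w₂, h₂⟩) hw
  refine ⟨fun ξ η hξ hη α hα β hβ => ?_, fun a b c d => ⟨(key _).trans ?_, (key _).trans ?_⟩⟩
  · have hξη : ‖ξ * η‖ = 1 := by rw [norm_mul, hξ, hη, one_mul]
    rw [key, PTSL.separatedCondition_eq_parityDual_iff (norm_ne_zero_iff.1 (hξ ▸ one_ne_zero)) hη,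
      PTSL.modEq_zero_pi_iff, PTSL.abs_modEq_zero_pi_iff, PTSL.mem_quarterTurns_iff hα,
      PTSL.mem_quarterTurns_iff hβ, Real.sin_add, Real.sin_sub]
    refine ⟨fun hdeg => ?_, fun ⟨hα', hβ'⟩ => ?_⟩
    · exact PTSL.add_mul_eq_zero_iff_of_mul_eq_zero (norm_ne_zero_iff.1 (hξη ▸ one_ne_zero))
        (by rw [mul_mul_mul_comm, mul_comm (Real.cos β)]; exact mul_eq_zero.2 hdeg)
    · exact PTSL.add_mul_eq_zero_iff_of_norm_eq_one hξη
        (mul_ne_zero (right_ne_zero_of_mul hα') (left_ne_zero_of_mul hβ'))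
  · exact PTSL.mixedConditionLeft_eq_parityDual_iff a b c d
  · exact (PTSL.mixedConditionRight_eq_parityDual_iff _).trans
      (PTSL.mixedConditionLeft_eq_parityDual_iff a b c d)
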